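/- Let $\mu$ be a finite positive Borel measure on the unit circle $\mathbb{T}$ with infinite support, and for $\mathfrak q\in\mathbb{R}$ and $t\in\mathbb{R}$ let $$d\mu^{(t)}(z)=e^{-t(\mathfrak q z+\mathfrak q/z)}\,d\mu(z).$$ Let $\Phi_n(z;t)$ and $\varphi_n(z;t)$ ($n\ge 0$) be the monic orthogonal and the orthonormal polynomials with respect to $\mu^{(t)}$, let $\mathfrak a_n(t)=-\overline{\Phi_{n+1}(0;t)}$ ($n\ge 0$) be the Verblunsky coefficients, $\rho_n^{(t)}=\Phi_n(1;t)/\Phi_n^*(1;t)$ with $\Phi_n^*(z;t)=z^n\overline{\Phi_n(1/\bar z;t)}$, and, for $n\ge 1$, $$g_n(t)=\frac12\,\frac{\big|1-\rho_{n-1}^{(t)}\mathfrak a_{n-1}(t)\big|^2}{1-\Re\big[\rho_{n-1}^{(t)}\mathfrak a_{n-1}(t)\big]},\qquad c_n(t)=\frac{\Im\big(\rho_{n-1}^{(t)}\mathfrak a_{n-1}(t)\big)}{\Re\big(\rho_{n-1}^{(t)}\mathfrak a_{n-1}(t)\big)-1},\qquad d_{n+1}(t)=[1-g_n(t)]\,g_{n+1}(t),$$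 and $d_1(t)=0$. Let $R_n(z;t)=2^n\xi_n(t)\sum_{j=0}^n\overline{\varphi_j(1;t)}\,\varphi_j(z;t)$, where $\xi_n(t)=\mu^{(t)}(\mathbb{T})\prod_{j=1}^n(1-g_j(t))$, be the normalized Christoffel–Darboux kernels. Suppose that $\mu$ is symmetric with respect to the real axis, that is, invariant under $z\mapsto\bar z$ (in terms of $\theta$, $d\mu(e^{i\theta})=-d\mu(e^{i(2\pi-\theta)})$). Then, for every $t\in\mathbb{R}$, the numbers $c_n(t)$ ($n\ge1$) and $d_n(t)$ ($n\ge 2$) are the unique real coefficients for which $R_0=1$, $R_1(z;t)=(1+ic_1)z+(1-ic_1)$ and $$R_{n+1}(z;t)=[(1+ic_{n+1})z+(1-ic_{n+1})]R_n(z;t)-4d_{n+1}\,z\,R_{n-1}(z;t),\qquad n\ge 1.$$ Moreover, $c_n(t)=0$ for all $n\ge 1$ and $t\in\mathbb{R}$, and the $d_n$ are differentiable in $t$ and satisfy the Langmuir-type lattice equations $$\dot d_n=4\mathfrak q\,d_n\,(d_{n-1}-d_{n+1}),\qquad n\ge 2,\qquad\text{with } d_1(t)=0.$$ -/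

import Mathlib

noncomputable section

namespace CircleKernel

open Polynomial MeasureTheory
open scoped ComplexConjugate

/-- The unit circle carries its Borel σ-algebra. -/
instance instMeasurableSpaceCircle : MeasurableSpace Circle := borel Circle

instance instBorelSpaceCircle : BorelSpace Circle := ⟨rfl⟩

/-- The modified measure `dμ^{(t)}(z) = e^{-t(conj q * z + q / z)} dμ(z)` on the unit circle. For
`z = e^{iθ}` the exponent is `-2t (Re q cos θ + Im q sin θ)`. -/
def modified (μ : Measure Circle) (q : ℂ) (t : ℝ) : Measure Circle :=
  μ.withDensity fun z : Circle =>
    ENNReal.ofReal (Real.exp (-(2 * t * (q.re * (z : ℂ).re + q.im * (z : ℂ).im))))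

/-- The sesquilinear form `⟨P, Q⟩ = ∫ conj (P z) * Q z dν(z)` on polynomials. -/
def ip (ν : Measure Circle) (P Q : ℂ[X]) : ℂ :=
  ∫ z : Circle, conj (P.eval (z : ℂ)) * Q.eval (z : ℂ) ∂ν

/-- The monic orthogonal polynomials `Φ_n` of `ν`, obtained from `1, z, z², …` by the
Gram-Schmidt process (without normalisation). -/
def monicOP (ν : Measure Circle) (n : ℕ) : ℂ[X] :=
  X ^ n - ∑ j : Fin n,
    C (ip ν (monicOP ν j) (X ^ n) / ip ν (monicOP ν j) (monicOP ν j)) * monicOP ν j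
termination_by n
decreasing_by exact j.isLt

/-- The orthonormal polynomials `φ_n = Φ_n / ‖Φ_n‖`, the norm being that of `L²(ν)`. -/
def orthonormalOP (ν : Measure Circle) (n : ℕ) : ℂ[X] :=
  C (((Real.sqrt (∫ z : Circle, ‖(monicOP ν n).eval (z : ℂ)‖ ^ 2 ∂ν))⁻¹ : ℝ) : ℂ) * monicOP ν n

/-- The Verblunsky coefficients `a_n = - conj (Φ_{n+1}(0))`, `n ≥ 0`. -/
def verblunsky (ν : Measure Circle) (n : ℕ) : ℂ :=
  -conj ((monicOP ν (n + 1)).eval 0)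

/-- The reciprocal polynomials `Φ_n^*(w) = w^n * conj (Φ_n(1 / conj w))`, as functions of `w`. -/
def reciprocalOP (ν : Measure Circle) (n : ℕ) (w : ℂ) : ℂ :=
  w ^ n * conj ((monicOP ν n).eval (1 / conj w))

/-- `ρ_n(w) = Φ_n(w) / Φ_n^*(w)`. -/
def rho (ν : Measure Circle) (n : ℕ) (w : ℂ) : ℂ :=
  (monicOP ν n).eval w / reciprocalOP ν n w

/-- `g_n = |1 - ρ_{n-1}(1) a_{n-1}|² / (2 (1 - Re (ρ_{n-1}(1) a_{n-1})))`, for `n ≥ 1`. -/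
def g (ν : Measure Circle) (n : ℕ) : ℝ :=
  1 / 2 * (‖1 - rho ν (n - 1) 1 * verblunsky ν (n - 1)‖ ^ 2 /
    (1 - (rho ν (n - 1) 1 * verblunsky ν (n - 1)).re))

/-- `ξ_n = ν(𝕋) ∏_{j=1}^n (1 - g_j)`. -/
def xi (ν : Measure Circle) (n : ℕ) : ℝ :=
  ν.real Set.univ * ∏ j ∈ Finset.Icc 1 n, (1 - g ν j)

/-- The Christoffel-Darboux kernel `K_n(z, w) = ∑_{j=0}^n conj (φ_j(w)) φ_j(z)`, as a polynomial
in `z`. -/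
def cdKernel (ν : Measure Circle) (n : ℕ) (w : ℂ) : ℂ[X] :=
  ∑ j ∈ Finset.range (n + 1), C (conj ((orthonormalOP ν j).eval w)) * orthonormalOP ν j

/-- The normalised kernels `R_n(z) = 2^n ξ_n K_n(z, 1)`. -/
def R (ν : Measure Circle) (n : ℕ) : ℂ[X] :=
  C ((2 ^ n * xi ν n : ℝ) : ℂ) * cdKernel ν n 1

/-- `c` and `d` are the coefficients of the three term recurrence relation of the kernels `R_n`:
`R_0 = 1`, `R_1 = (1 + i c_1) z + (1 - i c_1)` and, for `n ≥ 1`,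
`R_{n+1} = [(1 + i c_{n+1}) z + (1 - i c_{n+1})] R_n - 4 d_{n+1} z R_{n-1}`. -/
def IsRecurrence (ν : Measure Circle) (c d : ℕ → ℝ) : Prop :=
  R ν 0 = 1 ∧
  R ν 1 = C (1 + Complex.I * (c 1 : ℂ)) * X + C (1 - Complex.I * (c 1 : ℂ)) ∧
  ∀ n : ℕ, 1 ≤ n →
    R ν (n + 1) =
      (C (1 + Complex.I * (c (n + 1) : ℂ)) * X + C (1 - Complex.I * (c (n + 1) : ℂ))) * R ν n
        - C (4 * (d (n + 1) : ℂ)) * X * R ν (n - 1)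

/-- `c_0 = 1` and `c_n = Im (ρ_{n-1}(1) a_{n-1}) / (Re (ρ_{n-1}(1) a_{n-1}) - 1)`, `n ≥ 1`. -/
def cCoeff (ν : Measure Circle) : ℕ → ℝ
  | 0 => 1
  | n + 1 => (rho ν n 1 * verblunsky ν n).im / ((rho ν n 1 * verblunsky ν n).re - 1)

/-- `d_1 = 0` and `d_{n+1} = (1 - g_n) g_{n+1}`, `n ≥ 1` (`d_0` is not used). -/
def dCoeff (ν : Measure Circle) : ℕ → ℝ
  | 0 => 0
  | 1 => 0
  | n + 2 => (1 - g ν (n + 1)) * g ν (n + 2)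

end CircleKernel

end

/-!
Let `B_t p r = ∫ p(1/z) r(z) dμ^{(t)}(z)` on real polynomials. Since `μ` is invariant under complex
conjugation, so is `μ^{(t)}`, and `B_t` is a real symmetric form; it is positive definite because the
support is infinite, and multiplication by `X` is an isometry for it (`IsToeplitz`). All orthogonal
polynomials are therefore real and are generated by the Szegő recursion
`P_{n+1} = X P_n - a_n Q_n`, `Q_{n+1} = Q_n - a_n X P_n` with real `a_n ∈ (-1, 1)` (`monicOP_eq`,
`verblunsky_eq`). Both recursions give `P_n(1) = Q_n(1)`, so `ρ_n = 1`, whence `c_n = 0`,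
`g_n = (1 - a_{n-1}) / 2` and `4 d_{n+1} = (1 - a_n) (1 + a_{n-1})`.

The kernel `R_n` satisfies the Christoffel-Darboux formula `(1 - X) R_n = Q_n - X P_n`
(`one_sub_X_mul_szegoKernel`), and the Szegő recursion turns this into the three term recurrence
(`szegoKernel_recurrence`). Uniqueness of the coefficients is read off from leading coefficients
(`isRecurrence_iff`).

For the evolution in `t`, the weight satisfies
`d/dt B_t p r = -q (B_t (X p) r + B_t p (X r))` (`hasDerivAt_form`). As `Q_n / h_n` reproduces the
value at `0` of polynomials of degree at most `n`, the increment of `a_n = -P_{n+1}(0)` can be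
expressed by the increment of the form alone, which gives the Schur flow
`a_n' = -q (1 - a_n²) (a_{n+1} - a_{n-1})`, `a_{-1} = -1` (`hasDerivAt_szegoCoeff`). Inserting it into
`4 d_n = (1 - a_{n-1}) (1 + a_{n-2})` gives the lattice equations; the convention `a_{-1} = -1`
corresponds to `d_1 = 0`.
-/

namespace CircleKernel

open Polynomial MeasureTheory
open scoped ComplexConjugate

/-! ### Szegő recursion for a real Toeplitz form -/

/-- A positive definite symmetric bilinear form on real polynomials for which multiplication by
`X` is an isometry, that is, whose Gram matrix in the monomial basis is a Toeplitz matrix. -/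
structure IsToeplitz (B : ℝ[X] →ₗ[ℝ] ℝ[X] →ₗ[ℝ] ℝ) : Prop where
  symm : ∀ p r, B p r = B r p
  shift : ∀ p r, B (X * p) (X * r) = B p r
  pos : ∀ p, p ≠ 0 → 0 < B p p

/-- The pair `(P_n, Q_n)` of the monic orthogonal polynomial and its reversal, generated by the
Szegő recursion `P_{n+1} = X P_n - a_n Q_n`, `Q_{n+1} = Q_n - a_n X P_n` with
`a_n = B (X P_n) 1 / B P_n X^n`. -/
noncomputable def szegoPair (B : ℝ[X] →ₗ[ℝ] ℝ[X] →ₗ[ℝ] ℝ) : ℕ → ℝ[X] × ℝ[X]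
  | 0 => (1, 1)
  | n + 1 =>
    (X * (szegoPair B n).1 -
        C (B (X * (szegoPair B n).1) 1 / B (szegoPair B n).1 (X ^ n)) * (szegoPair B n).2,
      (szegoPair B n).2 -
        C (B (X * (szegoPair B n).1) 1 / B (szegoPair B n).1 (X ^ n)) * (X * (szegoPair B n).1))

/-- The monic polynomials `P_n` of the Szegő recursion. -/
noncomputable def szegoP (B : ℝ[X] →ₗ[ℝ] ℝ[X] →ₗ[ℝ] ℝ) (n : ℕ) : ℝ[X] := (szegoPair B n).1

/-- The reversed polynomials `Q_n` of the Szegő recursion. -/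
noncomputable def szegoQ (B : ℝ[X] →ₗ[ℝ] ℝ[X] →ₗ[ℝ] ℝ) (n : ℕ) : ℝ[X] := (szegoPair B n).2

/-- `h_n = B P_n X^n`, which is the square of the norm of `P_n`. -/
noncomputable def szegoNormSq (B : ℝ[X] →ₗ[ℝ] ℝ[X] →ₗ[ℝ] ℝ) (n : ℕ) : ℝ := B (szegoP B n) (X ^ n)

/-- The coefficients `a_n` of the Szegő recursion. -/
noncomputable def szegoCoeff (B : ℝ[X] →ₗ[ℝ] ℝ[X] →ₗ[ℝ] ℝ) (n : ℕ) : ℝ :=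
  B (X * szegoP B n) 1 / szegoNormSq B n

/-- The Christoffel-Darboux kernel at the point `1`, normalised to take the value `1` at `0`. -/
noncomputable def szegoKernel (B : ℝ[X] →ₗ[ℝ] ℝ[X] →ₗ[ℝ] ℝ) (n : ℕ) : ℝ[X] :=
  C (szegoNormSq B n / (szegoP B n).eval 1) *
    ∑ j ∈ Finset.range (n + 1), C ((szegoP B j).eval 1 / szegoNormSq B j) * szegoP B j

section Algebra

variable (B : ℝ[X] →ₗ[ℝ] ℝ[X] →ₗ[ℝ] ℝ)

@[simp] lemma szegoP_zero : szegoP B 0 = 1 := rfl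

@[simp] lemma szegoQ_zero : szegoQ B 0 = 1 := rfl

lemma szegoP_succ (n : ℕ) :
    szegoP B (n + 1) = X * szegoP B n - C (szegoCoeff B n) * szegoQ B n := rfl

lemma szegoQ_succ (n : ℕ) :
    szegoQ B (n + 1) = szegoQ B n - C (szegoCoeff B n) * (X * szegoP B n) := rfl

lemma natDegree_szego_le (n : ℕ) :
    (szegoP B n).natDegree ≤ n ∧ (szegoQ B n).natDegree ≤ n := by
  induction n with
  | zero => simp
  | succ n ih =>
    have hX : (X * szegoP B n).natDegree ≤ n + 1 :=
      natDegree_mul_le.trans (by have := natDegree_X_le (R := ℝ); omega)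
    have hC : ∀ (c : ℝ) (p : ℝ[X]), p.natDegree ≤ n + 1 → (C c * p).natDegree ≤ n + 1 :=
      fun c p hp => (natDegree_C_mul_le c p).trans hp
    rw [szegoP_succ, szegoQ_succ]
    exact ⟨(natDegree_sub_le_of_le hX (hC _ _ (by omega))).trans (by simp),
      (natDegree_sub_le_of_le (m := n + 1) (n := n + 1) (by omega) (hC _ _ hX)).trans (by simp)⟩

lemma coeff_szegoP_self (n : ℕ) : (szegoP B n).coeff n = 1 := by
  induction n with
  | zero => simp
  | succ n ih =>
    rw [szegoP_succ, coeff_sub, coeff_X_mul, coeff_C_mul, ih,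
      coeff_eq_zero_of_natDegree_lt (Nat.lt_succ_of_le (natDegree_szego_le B n).2)]
    simp

lemma szegoP_ne_zero (n : ℕ) : szegoP B n ≠ 0 := fun h => by
  simpa [h] using coeff_szegoP_self B n

lemma coeff_szegoQ_zero (n : ℕ) : (szegoQ B n).coeff 0 = 1 := by
  induction n with
  | zero => simp
  | succ n ih => simp [szegoQ_succ, ih]

lemma coeff_szegoP_succ_zero (n : ℕ) : (szegoP B (n + 1)).coeff 0 = -szegoCoeff B n := by
  simp [szegoP_succ, coeff_szegoQ_zero]

lemma coeff_szegoQ_succ_self (n : ℕ) :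
    (szegoQ B (n + 1)).coeff (n + 1) = -szegoCoeff B n := by
  rw [szegoQ_succ, coeff_sub, coeff_C_mul, coeff_X_mul, coeff_szegoP_self,
    coeff_eq_zero_of_natDegree_lt (Nat.lt_succ_of_le (natDegree_szego_le B n).2)]
  simp

lemma eval_one_szegoQ (n : ℕ) : (szegoQ B n).eval 1 = (szegoP B n).eval 1 := by
  induction n with
  | zero => simp
  | succ n ih => simp [szegoQ_succ, szegoP_succ, ih]

lemma eval_one_szegoP_succ (n : ℕ) :
    (szegoP B (n + 1)).eval 1 = (1 - szegoCoeff B n) * (szegoP B n).eval 1 := by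
  simp [szegoP_succ, eval_one_szegoQ]; ring

lemma form_C_mul_left (c : ℝ) (p r : ℝ[X]) : B (C c * p) r = c * B p r := by
  rw [← smul_eq_C_mul, map_smul, LinearMap.smul_apply, smul_eq_mul]

lemma form_C_mul_right (c : ℝ) (p r : ℝ[X]) : B p (C c * r) = c * B p r := by
  rw [← smul_eq_C_mul, map_smul, smul_eq_mul]

lemma form_eq_sum_right {N : ℕ} {r : ℝ[X]} (hr : r.natDegree < N) (p : ℝ[X]) :
    B p r = ∑ i ∈ Finset.range N, r.coeff i * B p (X ^ i) := by
  conv_lhs => rw [as_sum_range_C_mul_X_pow' r hr, map_sum]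
  simp_rw [form_C_mul_right]

lemma form_eq_sum_left {N : ℕ} {p : ℝ[X]} (hp : p.natDegree < N) (r : ℝ[X]) :
    B p r = ∑ i ∈ Finset.range N, p.coeff i * B (X ^ i) r := by
  conv_lhs => rw [as_sum_range_C_mul_X_pow' p hp, map_sum, LinearMap.sum_apply]
  simp_rw [form_C_mul_left]

variable {B}

/-- Once `P_n` is orthogonal to all lower powers, `h_n` is the squared norm of `P_n`. -/
lemma szegoNormSq_eq_self {n : ℕ} (h : ∀ k < n, B (szegoP B n) (X ^ k) = 0) :
    szegoNormSq B n = B (szegoP B n) (szegoP B n) := by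
  rw [form_eq_sum_right B (Nat.lt_succ_of_le (natDegree_szego_le B n).1),
    Finset.sum_range_succ, Finset.sum_eq_zero, coeff_szegoP_self, szegoNormSq]
  · simp
  · intro i hi
    rw [h i (Finset.mem_range.1 hi), mul_zero]

variable (hB : IsToeplitz B)
include hB

/-- Reversal symmetry of the Toeplitz form, `B Q_n (X^{n+k}) = B (X^k P_n) 1`, together with the
companion identity that makes the induction along the Szegő recursion close up. -/
lemma form_szego_reverse (n : ℕ) : ∀ k : ℕ,
    B (szegoQ B n) (X ^ (n + k)) = B (X ^ k * szegoP B n) 1 ∧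
      B (szegoP B n) (X ^ (n + k)) = B (X ^ k * szegoQ B n) 1 := by
  induction n with
  | zero => intro k; simp [hB.symm 1]
  | succ n ih =>
    intro k
    have e1 : B (X * szegoP B n) (X ^ (n + 1 + k)) = B (X ^ k * szegoQ B n) 1 := by
      rw [show n + 1 + k = (n + k) + 1 by ring, pow_succ', hB.shift, (ih k).2]
    have e2 : B (szegoQ B n) (X ^ (n + 1 + k)) = B (X ^ k * (X * szegoP B n)) 1 := by
      rw [show n + 1 + k = n + (k + 1) by ring, (ih (k + 1)).1]; congr 2; ring
    rw [szegoQ_succ, szegoP_succ, mul_sub, mul_sub, mul_left_comm _ (C _), mul_left_comm _ (C _)]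
    simp only [map_sub, LinearMap.sub_apply, form_C_mul_left, e1, e2, and_self]

lemma form_szegoQ_one (n : ℕ) : B (szegoQ B n) 1 = szegoNormSq B n := by
  simpa [szegoNormSq] using ((form_szego_reverse hB n 0).2).symm

/-- `P_n` is orthogonal to `1, …, X^{n-1}` and `Q_n` is orthogonal to `X, …, X^n`. -/
lemma szego_orthogonal (n : ℕ) :
    (∀ k < n, B (szegoP B n) (X ^ k) = 0) ∧ ∀ k < n, B (szegoQ B n) (X ^ (k + 1)) = 0 := by
  induction n with
  | zero => simp
  | succ n ih =>
    have hpos : szegoNormSq B n ≠ 0 := by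
      rw [szegoNormSq_eq_self ih.1]
      exact (hB.pos _ (szegoP_ne_zero B n)).ne'
    have ha : szegoCoeff B n * szegoNormSq B n = B (X * szegoP B n) 1 := by
      rw [szegoCoeff, div_mul_cancel₀ _ hpos]
    constructor
    · intro k hk
      rw [szegoP_succ, map_sub, LinearMap.sub_apply, form_C_mul_left]
      rcases k with _ | k
      · rw [pow_zero, form_szegoQ_one hB, ha, sub_self]
      · rw [ih.2 k (by omega), pow_succ', hB.shift, ih.1 k (by omega)]; simp
    · intro k hk
      rw [szegoQ_succ, map_sub, LinearMap.sub_apply, form_C_mul_left, pow_succ', hB.shift,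
        ← pow_succ']
      rcases Nat.lt_succ_iff_lt_or_eq.1 hk with h | rfl
      · rw [ih.2 k h, ih.1 k h]; simp
      · rw [(form_szego_reverse hB k 1).1, pow_one]
        rw [← szegoNormSq, ha, sub_self]

lemma szegoNormSq_pos (n : ℕ) : 0 < szegoNormSq B n := by
  rw [szegoNormSq_eq_self (szego_orthogonal hB n).1]
  exact hB.pos _ (szegoP_ne_zero B n)

lemma form_X_mul_szegoP_one (n : ℕ) :
    B (X * szegoP B n) 1 = szegoCoeff B n * szegoNormSq B n := by
  rw [szegoCoeff, div_mul_cancel₀ _ (szegoNormSq_pos hB n).ne']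

lemma form_szegoP_right {n : ℕ} {r : ℝ[X]} (hr : r.natDegree ≤ n) :
    B (szegoP B n) r = r.coeff n * szegoNormSq B n := by
  rw [form_eq_sum_right B (Nat.lt_succ_of_le hr), Finset.sum_range_succ, Finset.sum_eq_zero,
    zero_add, szegoNormSq]
  intro i hi
  rw [(szego_orthogonal hB n).1 i (Finset.mem_range.1 hi), mul_zero]

/-- `Q_n / h_n` is the reproducing kernel at `0` of the polynomials of degree at most `n`. -/
lemma form_szegoQ_right {n : ℕ} {r : ℝ[X]} (hr : r.natDegree ≤ n) :
    B (szegoQ B n) r = r.coeff 0 * szegoNormSq B n := by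
  rw [form_eq_sum_right B (Nat.lt_succ_of_le hr), Finset.sum_range_succ', Finset.sum_eq_zero,
    zero_add, pow_zero, form_szegoQ_one hB]
  intro i hi
  rw [(szego_orthogonal hB n).2 i (Finset.mem_range.1 hi), mul_zero]

lemma szegoNormSq_succ (n : ℕ) :
    szegoNormSq B (n + 1) = (1 - szegoCoeff B n ^ 2) * szegoNormSq B n := by
  have h1 := (form_szego_reverse hB n 1).1
  rw [pow_one, form_X_mul_szegoP_one hB] at h1
  rw [szegoNormSq, szegoP_succ, map_sub, LinearMap.sub_apply, form_C_mul_left, h1, pow_succ',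
    hB.shift, ← szegoNormSq]
  ring

lemma abs_szegoCoeff_lt_one (n : ℕ) : |szegoCoeff B n| < 1 := by
  have h := szegoNormSq_pos hB (n + 1)
  rw [szegoNormSq_succ hB] at h
  have := (pos_iff_pos_of_mul_pos h).2 (szegoNormSq_pos hB n)
  rw [← sq_lt_one_iff_abs_lt_one]; linarith

lemma one_sub_szegoCoeff_pos (n : ℕ) : 0 < 1 - szegoCoeff B n := by
  linarith [(abs_lt.1 (abs_szegoCoeff_lt_one hB n)).2]

lemma eval_one_szegoP_ne_zero (n : ℕ) : (szegoP B n).eval 1 ≠ 0 := by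
  induction n with
  | zero => simp
  | succ n ih =>
    rw [eval_one_szegoP_succ]
    exact mul_ne_zero (one_sub_szegoCoeff_pos hB n).ne' ih

/-- Fourier expansion in the orthogonal basis `P_0, P_1, …`. -/
lemma eq_sum_szegoP (N : ℕ) : ∀ p : ℝ[X], (∀ k, N ≤ k → p.coeff k = 0) →
    p = ∑ j ∈ Finset.range N, C (B (szegoP B j) p / szegoNormSq B j) * szegoP B j := by
  induction N with
  | zero => intro p hp; ext k; simp [hp k]
  | succ N ih =>
    intro p hp
    have hdeg : p.natDegree ≤ N := natDegree_le_iff_coeff_eq_zero.2 fun k hk => hp k hk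
    have hlow : ∀ k, N ≤ k → (p - C (p.coeff N) * szegoP B N).coeff k = 0 := by
      intro k hk
      rcases hk.eq_or_lt with rfl | hk
      · simp [coeff_szegoP_self]
      · rw [coeff_sub, coeff_C_mul, hp k hk, coeff_eq_zero_of_natDegree_lt
          ((natDegree_szego_le B N).1.trans_lt hk)]
        simp
    have h := ih _ hlow
    rw [Finset.sum_range_succ, form_szegoP_right hB hdeg,
      mul_div_cancel_right₀ _ (szegoNormSq_pos hB N).ne', ← sub_eq_iff_eq_add]
    refine h.trans (Finset.sum_congr rfl fun j hj => ?_)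
    rw [map_sub, form_C_mul_right, hB.symm _ (szegoP B N), form_szegoP_right hB
        ((natDegree_szego_le B j).1.trans (Finset.mem_range.1 hj).le),
      coeff_eq_zero_of_natDegree_lt
        ((natDegree_szego_le B j).1.trans_lt (Finset.mem_range.1 hj))]
    simp

/-- The `P_n` are what the Gram-Schmidt process makes of `1, X, X², …`. -/
lemma szegoP_eq_gramSchmidt (n : ℕ) :
    szegoP B n = X ^ n -
      ∑ j ∈ Finset.range n, C (B (szegoP B j) (X ^ n) / szegoNormSq B j) * szegoP B j := by
  have h := eq_sum_szegoP hB n (X ^ n - szegoP B n) (by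
    intro k hk
    rcases hk.eq_or_lt with rfl | hk
    · simp [coeff_szegoP_self]
    · rw [coeff_sub, coeff_X_pow, if_neg hk.ne', coeff_eq_zero_of_natDegree_lt
        ((natDegree_szego_le B n).1.trans_lt hk), sub_zero])
  rw [eq_sub_iff_add_eq, ← eq_sub_iff_add_eq']
  refine (Finset.sum_congr rfl fun j hj => ?_).trans h.symm
  rw [map_sub, hB.symm _ (szegoP B n), form_szegoP_right hB
      ((natDegree_szego_le B j).1.trans (Finset.mem_range.1 hj).le),
    coeff_eq_zero_of_natDegree_lt
      ((natDegree_szego_le B j).1.trans_lt (Finset.mem_range.1 hj)), zero_mul, sub_zero]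

/-! ### Normalised Christoffel-Darboux kernels -/

lemma szegoKernel_zero : szegoKernel B 0 = 1 := by
  have := (szegoNormSq_pos hB 0).ne'
  simp [szegoKernel, ← C_mul, this]

lemma szegoKernel_succ (n : ℕ) :
    szegoKernel B (n + 1) = C (1 + szegoCoeff B n) * szegoKernel B n + szegoP B (n + 1) := by
  have h0 := (szegoNormSq_pos hB (n + 1)).ne'
  have h1 := eval_one_szegoP_ne_zero hB (n + 1)
  rw [szegoKernel, Finset.sum_range_succ, mul_add, ← mul_assoc _ _ (szegoP B (n + 1)), ← C_mul,
    div_mul_div_cancel₀ h1, div_self h0, C_1, one_mul, szegoKernel, ← mul_assoc, ← C_mul]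
  congr 3
  have h2 := eval_one_szegoP_ne_zero hB n
  have h3 := (one_sub_szegoCoeff_pos hB n).ne'
  rw [eval_one_szegoP_succ, szegoNormSq_succ hB]
  field_simp
  ring

/-- Christoffel-Darboux formula. -/
lemma one_sub_X_mul_szegoKernel (n : ℕ) :
    (1 - X) * szegoKernel B n = szegoQ B n - X * szegoP B n := by
  induction n with
  | zero => simp [szegoKernel_zero hB]
  | succ n ih =>
    rw [szegoKernel_succ hB, mul_add, mul_left_comm, ih, szegoQ_succ, szegoP_succ]
    simp only [map_add, C_1]
    ring

lemma szegoKernel_one : szegoKernel B 1 = X + 1 := by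
  rw [szegoKernel_succ hB, szegoKernel_zero hB, szegoP_succ]
  simp only [map_add, C_1, szegoP_zero, szegoQ_zero]
  ring

lemma szegoKernel_recurrence (n : ℕ) :
    szegoKernel B (n + 2) = (X + 1) * szegoKernel B (n + 1) -
      C ((1 - szegoCoeff B (n + 1)) * (1 + szegoCoeff B n)) * X * szegoKernel B n := by
  have hne : (1 - X : ℝ[X]) ≠ 0 := fun h => by simpa using congrArg (eval 0) h
  refine mul_left_cancel₀ hne ?_
  rw [mul_sub, mul_left_comm, mul_left_comm (1 - X) (C _ * X), one_sub_X_mul_szegoKernel hB,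
    one_sub_X_mul_szegoKernel hB, one_sub_X_mul_szegoKernel hB, szegoQ_succ B (n + 1),
    szegoP_succ B (n + 1), szegoQ_succ B n, szegoP_succ B n]
  simp only [map_add, map_sub, map_mul, C_1]
  ring

lemma natDegree_szegoKernel_le (n : ℕ) : (szegoKernel B n).natDegree ≤ n := by
  induction n with
  | zero => simp [szegoKernel_zero hB]
  | succ n ih =>
    rw [szegoKernel_succ hB]
    exact natDegree_add_le_of_degree_le
      ((natDegree_C_mul_le _ _).trans (ih.trans n.le_succ)) (natDegree_szego_le B (n + 1)).1

lemma coeff_szegoKernel_self (n : ℕ) : (szegoKernel B n).coeff n = 1 := by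
  rcases n with _ | n
  · simp [szegoKernel_zero hB]
  · rw [szegoKernel_succ hB, coeff_add, coeff_C_mul, coeff_szegoP_self,
      coeff_eq_zero_of_natDegree_lt (Nat.lt_succ_of_le (natDegree_szegoKernel_le hB n))]
    simp

end Algebra

/-! ### The Toeplitz form of a symmetric measure on the circle -/

lemma continuous_integrand (P Q : ℂ[X]) :
    Continuous fun z : Circle => conj (P.eval (z : ℂ)) * Q.eval (z : ℂ) :=
  (Complex.continuous_conj.comp (P.continuous.comp continuous_subtype_val)).mul
    (Q.continuous.comp continuous_subtype_val)

section Measure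

variable (ν : Measure Circle) [IsFiniteMeasure ν]

lemma integrable_of_continuous {E : Type*} [NormedAddCommGroup E] {f : Circle → E}
    (hf : Continuous f) : Integrable f ν :=
  hf.integrable_of_hasCompactSupport (HasCompactSupport.of_compactSpace f)

lemma ip_add_left (P P' Q : ℂ[X]) : ip ν (P + P') Q = ip ν P Q + ip ν P' Q := by
  rw [ip, ip, ip, ← integral_add (integrable_of_continuous ν (continuous_integrand _ _))
    (integrable_of_continuous ν (continuous_integrand _ _))]
  exact integral_congr_ae (ae_of_all _ fun z => by simp [add_mul])

lemma ip_add_right (P Q Q' : ℂ[X]) : ip ν P (Q + Q') = ip ν P Q + ip ν P Q' := by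
  rw [ip, ip, ip, ← integral_add (integrable_of_continuous ν (continuous_integrand _ _))
    (integrable_of_continuous ν (continuous_integrand _ _))]
  exact integral_congr_ae (ae_of_all _ fun z => by simp [mul_add])

omit [IsFiniteMeasure ν] in
lemma ip_C_mul_left (c : ℂ) (P Q : ℂ[X]) : ip ν (C c * P) Q = conj c * ip ν P Q := by
  rw [ip, ip, ← integral_const_mul]
  exact integral_congr_ae (ae_of_all _ fun z => by simp [mul_assoc])

omit [IsFiniteMeasure ν] in
lemma ip_C_mul_right (c : ℂ) (P Q : ℂ[X]) : ip ν P (C c * Q) = c * ip ν P Q := by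
  rw [ip, ip, ← integral_const_mul]
  exact integral_congr_ae (ae_of_all _ fun z => by simp [mul_left_comm])

omit [IsFiniteMeasure ν] in
lemma ip_conj_symm (P Q : ℂ[X]) : conj (ip ν P Q) = ip ν Q P := by
  rw [ip, ip, ← integral_conj]
  exact integral_congr_ae (ae_of_all _ fun z => by simp [mul_comm])

omit [IsFiniteMeasure ν] in
lemma ip_shift (P Q : ℂ[X]) : ip ν (X * P) (X * Q) = ip ν P Q := by
  refine integral_congr_ae (ae_of_all _ fun z => ?_)
  have hz : conj (z : ℂ) * z = 1 := by
    rw [← Complex.normSq_eq_conj_mul_self, Circle.normSq_coe, Complex.ofReal_one]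
  simp only [eval_mul, eval_X, map_mul]
  linear_combination (conj (P.eval (z : ℂ)) * Q.eval (z : ℂ)) * hz

omit [IsFiniteMeasure ν] in
lemma ip_self (P : ℂ[X]) : ip ν P P = ((∫ z : Circle, ‖P.eval (z : ℂ)‖ ^ 2 ∂ν : ℝ) : ℂ) := by
  rw [ip, ← integral_complex_ofReal]
  exact integral_congr_ae (ae_of_all _ fun z => by simp [Complex.conj_mul'])

/-- A polynomial of norm zero vanishes almost everywhere, hence by continuity on the whole support,
which is infinite. -/
lemma ip_self_ne_zero (hν : ν.support.Infinite) {P : ℂ[X]} (hP : P ≠ 0) : ip ν P P ≠ 0 := by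
  intro h
  rw [ip_self, Complex.ofReal_eq_zero, integral_eq_zero_iff_of_nonneg (fun z => by positivity)
    (integrable_of_continuous ν (by have := P.continuous; fun_prop))] at h
  have hopen : IsOpen {z : Circle | P.eval (z : ℂ) ≠ 0} :=
    isOpen_ne.preimage (P.continuous.comp continuous_subtype_val)
  have hzero : ν {z : Circle | P.eval (z : ℂ) ≠ 0} = 0 := by
    refine measure_mono_null (fun z hz => ?_) (ae_iff.1 h)
    simpa using hz
  have hsub : ν.support ⊆ {z : Circle | P.eval (z : ℂ) = 0} := fun z hz => by
    by_contra hne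
    exact Measure.subset_compl_support_of_isOpen hopen hzero hne hz
  refine hν (Set.Finite.subset ?_ hsub)
  refine Set.Finite.of_finite_image (f := fun z : Circle => (z : ℂ))
    ((P.roots.toFinset.finite_toSet).subset ?_) Subtype.val_injective.injOn
  rintro _ ⟨z, hz, rfl⟩
  simpa [hP] using hz

/-- The form `∫ p(1/z) r(z) dν(z)` on real polynomials; for a measure invariant under complex
conjugation the integral is real, in general its real part is taken. -/
noncomputable def form : ℝ[X] →ₗ[ℝ] ℝ[X] →ₗ[ℝ] ℝ :=
  LinearMap.mk₂ ℝ
    (fun p r => (ip ν (p.map Complex.ofRealHom) (r.map Complex.ofRealHom)).re)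
    (fun p p' r => by simp [ip_add_left])
    (fun c p r => by
      rw [smul_eq_C_mul, Polynomial.map_mul, map_C, ip_C_mul_left]; simp)
    (fun p r r' => by simp [ip_add_right])
    (fun c p r => by
      rw [smul_eq_C_mul, Polynomial.map_mul, map_C, ip_C_mul_right]; simp)

lemma form_apply (p r : ℝ[X]) :
    form ν p r = (ip ν (p.map Complex.ofRealHom) (r.map Complex.ofRealHom)).re := rfl

lemma isToeplitz_form (hν : ν.support.Infinite) : IsToeplitz (form ν) where
  symm p r := by rw [form_apply, form_apply, ← ip_conj_symm, Complex.conj_re]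
  shift p r := by
    simp only [form_apply, Polynomial.map_mul, map_X, ip_shift]
  pos p hp := by
    have h := ip_self_ne_zero ν hν (P := p.map Complex.ofRealHom)
      ((Polynomial.map_ne_zero_iff Complex.ofRealHom.injective).2 hp)
    rw [form_apply]
    rw [ip_self] at h ⊢
    rw [Complex.ofReal_re]
    exact lt_of_le_of_ne (integral_nonneg fun z => by positivity)
      (Ne.symm (Complex.ofReal_ne_zero.1 h))

variable {ν}

omit [IsFiniteMeasure ν] in
lemma eval_map_inv (p : ℝ[X]) (z : Circle) :
    (p.map Complex.ofRealHom).eval ((z⁻¹ : Circle) : ℂ) =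
      conj ((p.map Complex.ofRealHom).eval (z : ℂ)) := by
  rw [Circle.coe_inv_eq_conj, eval_map, eval_map, hom_eval₂]
  congr 1
  ext x
  simp

omit [IsFiniteMeasure ν] in
lemma eval_one_map (p : ℝ[X]) :
    (p.map Complex.ofRealHom).eval 1 = ((p.eval 1 : ℝ) : ℂ) := by
  rw [eval_map, ← Complex.ofReal_one]
  exact eval₂_at_apply Complex.ofRealHom 1

lemma ip_map_ofReal (hsymm : ν.map (fun z : Circle => z⁻¹) = ν) (p r : ℝ[X]) :
    ip ν (p.map Complex.ofRealHom) (r.map Complex.ofRealHom) = (form ν p r : ℂ) := by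
  refine (Complex.conj_eq_iff_re.1 ?_).symm
  have hmeas : Measurable fun z : Circle => z⁻¹ := continuous_inv.measurable
  conv_rhs => rw [ip, ← hsymm, integral_map hmeas.aemeasurable
    (continuous_integrand _ _).aestronglyMeasurable]
  rw [ip, ← integral_conj]
  exact integral_congr_ae (ae_of_all _ fun z => by
    simp only [eval_map_inv, map_mul, Complex.conj_conj])

variable (hν : ν.support.Infinite) (hsymm : ν.map (fun z : Circle => z⁻¹) = ν)
include hν hsymm

/-! ### Orthogonal polynomials and kernels of a symmetric measure -/

lemma monicOP_eq (n : ℕ) : monicOP ν n = (szegoP (form ν) n).map Complex.ofRealHom := by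
  have hT := isToeplitz_form ν hν
  induction n using Nat.strong_induction_on with
  | _ n ih =>
    rw [monicOP, szegoP_eq_gramSchmidt hT n, Polynomial.map_sub, Polynomial.map_pow, map_X,
      Polynomial.map_sum, ← Finset.sum_range fun j =>
        C (ip ν (monicOP ν j) (X ^ n) / ip ν (monicOP ν j) (monicOP ν j)) * monicOP ν j]
    congr 1
    refine Finset.sum_congr rfl fun j hj => ?_
    have hX : (X ^ n : ℂ[X]) = (X ^ n : ℝ[X]).map Complex.ofRealHom := by simp
    rw [ih j (Finset.mem_range.1 hj), hX, ip_map_ofReal hsymm, ip_map_ofReal hsymm,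
      ← szegoNormSq_eq_self (szego_orthogonal hT j).1, Polynomial.map_mul, map_C]
    simp

lemma eval_one_monicOP (n : ℕ) :
    (monicOP ν n).eval 1 = (((szegoP (form ν) n).eval 1 : ℝ) : ℂ) := by
  rw [monicOP_eq hν hsymm, eval_one_map]

lemma rho_one (n : ℕ) : rho ν n 1 = 1 := by
  have h := eval_one_szegoP_ne_zero (isToeplitz_form ν hν) n
  rw [rho, reciprocalOP, map_one, div_one, eval_one_monicOP hν hsymm, one_pow, one_mul,
    Complex.conj_ofReal, div_self (Complex.ofReal_ne_zero.2 h)]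

lemma verblunsky_eq (n : ℕ) : verblunsky ν n = (szegoCoeff (form ν) n : ℂ) := by
  rw [verblunsky, monicOP_eq hν hsymm, ← coeff_zero_eq_eval_zero, coeff_map,
    coeff_szegoP_succ_zero]
  simp

lemma cCoeff_eq_zero (n : ℕ) (hn : 1 ≤ n) : cCoeff ν n = 0 := by
  obtain ⟨n, rfl⟩ := Nat.exists_eq_add_of_le' hn
  simp [cCoeff, rho_one hν hsymm, verblunsky_eq hν hsymm]

lemma g_succ (n : ℕ) : g ν (n + 1) = (1 - szegoCoeff (form ν) n) / 2 := by
  have h := (one_sub_szegoCoeff_pos (isToeplitz_form ν hν) n).ne'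
  rw [g, Nat.add_sub_cancel, rho_one hν hsymm, verblunsky_eq hν hsymm, one_mul,
    ← Complex.ofReal_one, ← Complex.ofReal_sub, Complex.norm_real, Real.norm_eq_abs, sq_abs,
    Complex.ofReal_re]
  field_simp

lemma dCoeff_add_two (n : ℕ) : dCoeff ν (n + 2) =
    (1 - szegoCoeff (form ν) (n + 1)) * (1 + szegoCoeff (form ν) n) / 4 := by
  rw [dCoeff, g_succ hν hsymm, g_succ hν hsymm]; ring

lemma xi_eq (n : ℕ) : 2 ^ n * xi ν n = szegoNormSq (form ν) n / (szegoP (form ν) n).eval 1 := by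
  have hT := isToeplitz_form ν hν
  induction n with
  | zero => simp [xi, szegoNormSq, form_apply, ip]
  | succ n ih =>
    have h2 := eval_one_szegoP_ne_zero hT n
    have h3 := (one_sub_szegoCoeff_pos hT n).ne'
    have hxi : xi ν (n + 1) = xi ν n * (1 - g ν (n + 1)) := by
      rw [xi, xi, Finset.prod_Icc_succ_top (by omega), mul_assoc]
    rw [hxi, pow_succ, show (2 : ℝ) ^ n * 2 * (xi ν n * (1 - g ν (n + 1))) =
      (2 ^ n * xi ν n) * (2 * (1 - g ν (n + 1))) by ring, ih, g_succ hν hsymm,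
      eval_one_szegoP_succ, szegoNormSq_succ hT]
    field_simp
    ring

lemma orthonormalOP_eq (n : ℕ) : orthonormalOP ν n =
    ((C (Real.sqrt (szegoNormSq (form ν) n))⁻¹ : ℝ[X]) * szegoP (form ν) n).map
      Complex.ofRealHom := by
  have hT := isToeplitz_form ν hν
  have h : (∫ z : Circle, ‖(monicOP ν n).eval (z : ℂ)‖ ^ 2 ∂ν) = szegoNormSq (form ν) n := by
    rw [szegoNormSq_eq_self (szego_orthogonal hT n).1, ← Complex.ofReal_inj, ← ip_self,
      monicOP_eq hν hsymm, ip_map_ofReal hsymm]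
  rw [orthonormalOP, h, monicOP_eq hν hsymm, Polynomial.map_mul, map_C]
  rfl

lemma R_eq (n : ℕ) : R ν n = (szegoKernel (form ν) n).map Complex.ofRealHom := by
  have hT := isToeplitz_form ν hν
  rw [R, xi_eq hν hsymm, szegoKernel, Polynomial.map_mul, map_C, cdKernel, Polynomial.map_sum]
  congr 1
  refine Finset.sum_congr rfl fun j _ => ?_
  have hs : (Real.sqrt (szegoNormSq (form ν) j))⁻¹ * (Real.sqrt (szegoNormSq (form ν) j))⁻¹ =
      (szegoNormSq (form ν) j)⁻¹ := by
    rw [← mul_inv, Real.mul_self_sqrt (szegoNormSq_pos hT j).le]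
  have he : conj ((orthonormalOP ν j).eval 1) =
      (((Real.sqrt (szegoNormSq (form ν) j))⁻¹ * (szegoP (form ν) j).eval 1 : ℝ) : ℂ) := by
    rw [orthonormalOP_eq hν hsymm, eval_one_map, Complex.conj_ofReal, eval_mul, eval_C]
  rw [he, orthonormalOP_eq hν hsymm, ← Complex.ofRealHom_eq_coe, ← map_C, ← Polynomial.map_mul,
    ← mul_assoc, ← C_mul, div_eq_mul_inv, ← hs]
  congr 3
  ring

lemma R_succ_succ (n : ℕ) : R ν (n + 2) =
    (X + 1) * R ν (n + 1) - C (4 * (dCoeff ν (n + 2) : ℂ)) * X * R ν n := by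
  have hd : (4 * (dCoeff ν (n + 2) : ℂ)) = Complex.ofRealHom
      ((1 - szegoCoeff (form ν) (n + 1)) * (1 + szegoCoeff (form ν) n)) := by
    rw [dCoeff_add_two hν hsymm, Complex.ofRealHom_eq_coe]
    push_cast
    ring
  rw [R_eq hν hsymm, R_eq hν hsymm, R_eq hν hsymm,
    szegoKernel_recurrence (isToeplitz_form ν hν), hd, ← map_C]
  simp only [Polynomial.map_sub, Polynomial.map_mul, Polynomial.map_add, map_X,
    Polynomial.map_one]

lemma R_ne_zero (n : ℕ) : R ν n ≠ 0 := fun h => by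
  have h1 := congrArg (fun p : ℂ[X] => p.coeff n) h
  simp [R_eq hν hsymm, coeff_szegoKernel_self (isToeplitz_form ν hν)] at h1

/-- The coefficients of the three term recurrence are determined by the kernels: comparing the
coefficients of `X^{n+1}` fixes `c_{n+1}`, and then `d_{n+1}` is fixed because `X R_{n-1} ≠ 0`. -/
theorem isRecurrence_iff (c d : ℕ → ℝ) :
    IsRecurrence ν c d ↔
      (∀ n : ℕ, 1 ≤ n → c n = cCoeff ν n) ∧ ∀ n : ℕ, 2 ≤ n → d n = dCoeff ν n := by
  have hT := isToeplitz_form ν hν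
  have hR0 : R ν 0 = 1 := by rw [R_eq hν hsymm, szegoKernel_zero hT, Polynomial.map_one]
  have hR1 : R ν 1 = X + 1 := by
    rw [R_eq hν hsymm, szegoKernel_one hT, Polynomial.map_add, map_X, Polynomial.map_one]
  have hdeg : ∀ n k, n < k → (R ν n).coeff k = 0 := fun n k hk => by
    rw [R_eq hν hsymm, coeff_map, coeff_eq_zero_of_natDegree_lt
      ((natDegree_szegoKernel_le hT n).trans_lt hk), map_zero]
  have hlead : ∀ n, (R ν n).coeff n = 1 := fun n => by
    rw [R_eq hν hsymm, coeff_map, coeff_szegoKernel_self hT, map_one]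
  have hI : ∀ x : ℝ, 1 = 1 + Complex.I * (x : ℂ) → x = 0 := fun x hx => by
    simpa using (congrArg Complex.im hx).symm
  constructor
  · rintro ⟨-, h1, h⟩
    have hc : ∀ n : ℕ, 1 ≤ n → c n = 0 := by
      intro n hn
      obtain ⟨n, rfl⟩ := Nat.exists_eq_add_of_le' hn
      rcases n with _ | n
      · refine hI _ ?_
        have := congrArg (fun p : ℂ[X] => p.coeff 1) (hR1.symm.trans h1)
        simpa [coeff_X, coeff_one, coeff_C] using this
      · refine hI _ ?_
        have h2 := congrArg (fun p : ℂ[X] => p.coeff (n + 2)) (h (n + 1) (by omega))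
        simp only [Nat.add_sub_cancel] at h2
        rw [hlead, coeff_sub, add_mul, coeff_add, mul_assoc, coeff_C_mul, coeff_X_mul, hlead,
          coeff_C_mul, hdeg _ _ (by omega), mul_assoc, coeff_C_mul, coeff_X_mul,
          hdeg _ _ (by omega)] at h2
        simpa using h2
    refine ⟨fun n hn => (hc n hn).trans (cCoeff_eq_zero hν hsymm n hn).symm, fun n hn => ?_⟩
    obtain ⟨n, rfl⟩ := Nat.exists_eq_add_of_le' hn
    have h2 := h (n + 1) (by omega)
    rw [show n + 1 + 1 = n + 2 from rfl, hc _ (by omega), R_succ_succ hν hsymm,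
      Nat.add_sub_cancel, Complex.ofReal_zero, mul_zero, add_zero, sub_zero, C_1, one_mul,
      sub_right_inj, mul_assoc, mul_assoc] at h2
    have h3 := C_injective (mul_right_cancel₀ (mul_ne_zero X_ne_zero (R_ne_zero hν hsymm n)) h2)
    exact (Complex.ofReal_injective (mul_left_cancel₀ (by norm_num : (4 : ℂ) ≠ 0) h3)).symm
  · rintro ⟨hc, hd⟩
    have hc0 : ∀ n : ℕ, 1 ≤ n → c n = 0 := fun n hn =>
      (hc n hn).trans (cCoeff_eq_zero hν hsymm n hn)
    refine ⟨hR0, ?_, fun n hn => ?_⟩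
    · rw [hR1, hc0 1 le_rfl]; simp
    · obtain ⟨n, rfl⟩ := Nat.exists_eq_add_of_le' hn
      rw [show n + 1 + 1 = n + 2 from rfl, hc0 _ (by omega), hd _ (by omega),
        R_succ_succ hν hsymm]
      simp

end Measure

/-! ### The modified measures -/

section Modified

variable (μ : Measure Circle) [IsFiniteMeasure μ]

instance isFiniteMeasure_modified (q : ℂ) (t : ℝ) : IsFiniteMeasure (modified μ q t) :=
  isFiniteMeasure_withDensity_ofReal (integrable_of_continuous μ (by fun_prop)).2

omit [IsFiniteMeasure μ] in
lemma measurable_density (q : ℂ) (t : ℝ) : Measurable fun z : Circle =>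
    ENNReal.ofReal (Real.exp (-(2 * t * (q.re * (z : ℂ).re + q.im * (z : ℂ).im)))) :=
  (Continuous.measurable (by fun_prop)).ennreal_ofReal

omit [IsFiniteMeasure μ] in
lemma support_modified_infinite (hμ : μ.support.Infinite) (q : ℂ) (t : ℝ) :
    (modified μ q t).support.Infinite :=
  hμ.mono (Measure.AbsolutelyContinuous.support_mono (withDensity_absolutelyContinuous'
    (measurable_density q t).aemeasurable
    (ae_of_all _ fun _ => (ENNReal.ofReal_pos.2 (Real.exp_pos _)).ne')))

omit [IsFiniteMeasure μ] in
variable {μ} in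
lemma map_inv_modified (hsymm : μ.map (fun z : Circle => z⁻¹) = μ) (q t : ℝ) :
    (modified μ (q : ℂ) t).map (fun z : Circle => z⁻¹) = modified μ (q : ℂ) t := by
  have hmeas : Measurable fun z : Circle => z⁻¹ := continuous_inv.measurable
  ext s hs
  rw [Measure.map_apply hmeas hs, modified, withDensity_apply _ (hmeas hs),
    withDensity_apply _ hs]
  conv_rhs => rw [← hsymm, setLIntegral_map hs (measurable_density _ _) hmeas]
  simp

lemma form_modified (q t : ℝ) (p r : ℝ[X]) : form (modified μ (q : ℂ) t) p r =
    ∫ z : Circle, Real.exp (-(2 * t * (q * (z : ℂ).re))) *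
      (conj ((p.map Complex.ofRealHom).eval (z : ℂ)) *
        (r.map Complex.ofRealHom).eval (z : ℂ)).re ∂μ := by
  have h := integral_re (𝕜 := ℂ) (integrable_of_continuous (modified μ (q : ℂ) t)
    (continuous_integrand (p.map Complex.ofRealHom) (r.map Complex.ofRealHom)))
  rw [form_apply, ip]
  refine h.symm.trans ?_
  rw [modified, integral_withDensity_eq_integral_toReal_smul (measurable_density _ _)
    (ae_of_all _ fun z => ENNReal.ofReal_lt_top)]
  refine integral_congr_ae (ae_of_all _ fun z => ?_)
  simp [ENNReal.toReal_ofReal (Real.exp_pos _).le]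

/-- Differentiating the weight multiplies the integrand by `-q (z + 1/z)`. -/
lemma hasDerivAt_form (q t : ℝ) (p r : ℝ[X]) :
    HasDerivAt (fun s => form (modified μ (q : ℂ) s) p r)
      (-q * (form (modified μ (q : ℂ) t) (X * p) r + form (modified μ (q : ℂ) t) p (X * r))) t := by
  set f : Circle → ℝ := fun z => (conj ((p.map Complex.ofRealHom).eval (z : ℂ)) *
        (r.map Complex.ofRealHom).eval (z : ℂ)).re with hf
  have hfc : Continuous f := Complex.continuous_re.comp (continuous_integrand _ _)
  set F' : ℝ → Circle → ℝ := fun s z =>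
    Real.exp (-(2 * s * (q * (z : ℂ).re))) * (-(2 * (q * (z : ℂ).re))) * f z with hF'
  have hre : ∀ z : Circle, |(z : ℂ).re| ≤ 1 := fun z =>
    (Complex.abs_re_le_norm _).trans (Circle.norm_coe z).le
  have key := hasDerivAt_integral_of_dominated_loc_of_deriv_le (μ := μ) (x₀ := t)
    (F := fun s z => Real.exp (-(2 * s * (q * (z : ℂ).re))) * f z) (F' := F')
    (bound := fun z => Real.exp (2 * (|t| + 1) * |q|) * (2 * |q|) * |f z|)
    (Metric.ball_mem_nhds t one_pos)
    (Filter.Eventually.of_forall fun s => Continuous.aestronglyMeasurable (by fun_prop))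
    (integrable_of_continuous μ (by fun_prop)) (Continuous.aestronglyMeasurable (by fun_prop))
    (ae_of_all _ fun z s hs => ?_) (integrable_of_continuous μ (by fun_prop))
    (ae_of_all _ fun z s _ => ?_)
  · simp_rw [form_modified μ q]
    refine key.2.congr_deriv ?_
    symm
    rw [← integral_add (integrable_of_continuous μ ?_) (integrable_of_continuous μ ?_),
      ← integral_const_mul]
    · refine integral_congr_ae (ae_of_all _ fun z => ?_)
      simp only [hF', hf, Polynomial.map_mul, map_X, eval_mul, eval_X, map_mul, Complex.mul_re,
        Complex.mul_im, Complex.conj_re, Complex.conj_im]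
      ring
    all_goals
      exact Continuous.mul (by fun_prop) (Complex.continuous_re.comp (continuous_integrand _ _))
  · have hs' : |s| ≤ |t| + 1 := by
      have h1 : |s - t| < 1 := by simpa [Real.dist_eq] using hs
      have h2 := abs_sub_abs_le_abs_sub s t
      linarith
    have hq : |q * (z : ℂ).re| ≤ |q| := by
      rw [abs_mul]; exact mul_le_of_le_one_right (abs_nonneg _) (hre z)
    rw [hF', Real.norm_eq_abs, abs_mul, abs_mul, Real.abs_exp, abs_neg, abs_mul, abs_two]
    gcongr
    refine (neg_le_abs _).trans ?_
    rw [abs_mul, abs_mul, abs_two]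
    gcongr
  · have h : HasDerivAt (fun s : ℝ => -(2 * s * (q * (z : ℂ).re))) (-(2 * (q * (z : ℂ).re))) s := by
      refine (((hasDerivAt_id s).const_mul 2).mul_const (q * (z : ℂ).re)).neg.congr_deriv ?_
      ring
    exact h.exp.mul_const (f z)

/-! ### Schur flow -/

variable {μ} (hμ : μ.support.Infinite) (q : ℝ)

omit hμ in
lemma differentiable_form {N : ℕ} {p : ℝ → ℝ[X]} (hN : ∀ s, (p s).natDegree < N)
    (hp : ∀ k, Differentiable ℝ fun s => (p s).coeff k) (r : ℝ[X]) :
    Differentiable ℝ fun s => form (modified μ (q : ℂ) s) (p s) r := by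
  have h : (fun s => form (modified μ (q : ℂ) s) (p s) r) = fun s =>
      ∑ i ∈ Finset.range N, (p s).coeff i * form (modified μ (q : ℂ) s) (X ^ i) r :=
    funext fun s => form_eq_sum_left _ (hN s) r
  rw [h]
  exact Differentiable.fun_sum fun i _ => (hp i).mul fun t =>
    (hasDerivAt_form μ q t _ _).differentiableAt

include hμ

lemma differentiable_coeff_szego (n : ℕ) : ∀ k,
    (Differentiable ℝ fun s => (szegoP (form (modified μ (q : ℂ) s)) n).coeff k) ∧
      Differentiable ℝ fun s => (szegoQ (form (modified μ (q : ℂ) s)) n).coeff k := by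
  induction n with
  | zero => simp
  | succ n ih =>
    have hX : ∀ k, Differentiable ℝ fun s =>
        (X * szegoP (form (modified μ (q : ℂ) s)) n).coeff k := by
      intro k
      rcases k with _ | k
      · simp
      · simpa using (ih k).1
    have ha : Differentiable ℝ fun s => szegoCoeff (form (modified μ (q : ℂ) s)) n := by
      refine Differentiable.fun_div (differentiable_form (N := n + 2) q (fun s => ?_) hX _)
        (differentiable_form (N := n + 1) q
          (fun s => Nat.lt_succ_of_le (natDegree_szego_le _ n).1) (fun k => (ih k).1) _) fun s =>
          (szegoNormSq_pos (isToeplitz_form _ (support_modified_infinite μ hμ q s)) n).ne'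
      have h1 := natDegree_mul_le (p := X) (q := szegoP (form (modified μ (q : ℂ) s)) n)
      have h2 := natDegree_X_le (R := ℝ)
      have h3 := (natDegree_szego_le (form (modified μ (q : ℂ) s)) n).1
      omega
    intro k
    simp only [szegoP_succ, szegoQ_succ, coeff_sub, coeff_C_mul]
    exact ⟨(hX k).sub (ha.mul (ih k).2), (ih k).2.sub (ha.mul (hX k))⟩

/-- The Schur flow. Here `(szegoQ _ n).coeff n` is `-a_{n-1}`, with the convention `a_{-1} = -1`.
The proof uses that `Q_n(t)` reproduces the value at `0`, so that
`(a_n(t) - a_n(s)) h_n(t) = (B_t - B_s) (P_{n+1}(s)) (Q_n(t))`; on the right the derivative at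
`s = t` falls on the form `B_s` alone. -/
lemma hasDerivAt_szegoCoeff (n : ℕ) (t : ℝ) :
    HasDerivAt (fun s => szegoCoeff (form (modified μ (q : ℂ) s)) n)
      (-q * (1 - szegoCoeff (form (modified μ (q : ℂ) t)) n ^ 2) *
        (szegoCoeff (form (modified μ (q : ℂ) t)) (n + 1) +
          (szegoQ (form (modified μ (q : ℂ) t)) n).coeff n)) t := by
  set B : ℝ → ℝ[X] →ₗ[ℝ] ℝ[X] →ₗ[ℝ] ℝ := fun s => form (modified μ (q : ℂ) s) with hBdef
  have hT : ∀ s, IsToeplitz (B s) := fun s =>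
    isToeplitz_form _ (support_modified_infinite μ hμ q s)
  have hQ := (natDegree_szego_le (B t) n).2
  have hcoeff0 : (szegoQ (B t) n).coeff (n + 1) = 0 :=
    coeff_eq_zero_of_natDegree_lt (Nat.lt_succ_of_le hQ)
  have hh := (szegoNormSq_pos (hT t) n).ne'
  have horth : ∀ s, B s (szegoP (B s) (n + 1)) (szegoQ (B t) n) = 0 := fun s => by
    rw [form_szegoP_right (hT s) (hQ.trans n.le_succ), hcoeff0, zero_mul]
  have hdiff : ∀ s, B t (szegoP (B s) (n + 1)) (szegoQ (B t) n) =
      (szegoCoeff (B t) n - szegoCoeff (B s) n) * szegoNormSq (B t) n := fun s => by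
    have hdeg : (szegoP (B s) (n + 1) - szegoP (B t) (n + 1)).natDegree ≤ n := by
      refine natDegree_le_iff_coeff_eq_zero.2 fun k hk => ?_
      rcases (Nat.succ_le_of_lt hk).eq_or_lt with rfl | hk
      · rw [coeff_sub, Nat.succ_eq_add_one, coeff_szegoP_self, coeff_szegoP_self, sub_self]
      · rw [coeff_sub, coeff_eq_zero_of_natDegree_lt ((natDegree_szego_le _ _).1.trans_lt hk),
          coeff_eq_zero_of_natDegree_lt ((natDegree_szego_le _ _).1.trans_lt hk), sub_self]
    have h := form_szegoQ_right (hT t) hdeg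
    rw [(hT t).symm, map_sub, LinearMap.sub_apply, horth, sub_zero, coeff_sub,
      coeff_szegoP_succ_zero, coeff_szegoP_succ_zero] at h
    rw [h]; ring
  have heq : (fun s => szegoCoeff (B s) n) = fun s => szegoCoeff (B t) n -
      (∑ i ∈ Finset.range (n + 2), (szegoP (B s) (n + 1)).coeff i *
        (B t (X ^ i) (szegoQ (B t) n) - B s (X ^ i) (szegoQ (B t) n))) / szegoNormSq (B t) n := by
    funext s
    have hlt := Nat.lt_succ_of_le (natDegree_szego_le (B s) (n + 1)).1
    simp_rw [mul_sub]
    rw [Finset.sum_sub_distrib, ← form_eq_sum_left (B t) hlt, ← form_eq_sum_left (B s) hlt, hdiff,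
      horth]
    field_simp
    ring
  -- The derivative of the coefficient of `P_{n+1}` drops out: its factor vanishes at `s = t`.
  have hterm : ∀ i, HasDerivAt (fun s => (szegoP (B s) (n + 1)).coeff i *
        (B t (X ^ i) (szegoQ (B t) n) - B s (X ^ i) (szegoQ (B t) n)))
      ((szegoP (B t) (n + 1)).coeff i * (q * (B t (X * X ^ i) (szegoQ (B t) n) +
        B t (X ^ i) (X * szegoQ (B t) n)))) t := fun i => by
    have h1 := ((differentiable_coeff_szego hμ q (n + 1) i).1 t).hasDerivAt
    have h2 := (hasDerivAt_form μ q t (X ^ i) (szegoQ (B t) n)).const_sub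
      (B t (X ^ i) (szegoQ (B t) n))
    refine (h1.mul h2).congr_deriv ?_
    simp [hBdef]
  have hlt := Nat.lt_succ_of_le (natDegree_szego_le (B t) (n + 1)).1
  -- `X P_{n+1} = P_{n+2} + a_{n+1} Q_{n+1}` pairs with `Q_n` through `Q_{n+1}` only, and `P_{n+1}`
  -- sees only the top coefficient of `X Q_n`.
  have hsum : ∑ i ∈ Finset.range (n + 2), (szegoP (B t) (n + 1)).coeff i *
      (q * (B t (X * X ^ i) (szegoQ (B t) n) + B t (X ^ i) (X * szegoQ (B t) n))) =
      q * ((szegoCoeff (B t) (n + 1) + (szegoQ (B t) n).coeff n) *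
        szegoNormSq (B t) (n + 1)) := by
    have e1 : B t (X * szegoP (B t) (n + 1)) (szegoQ (B t) n) =
        ∑ i ∈ Finset.range (n + 2), (szegoP (B t) (n + 1)).coeff i *
          B t (X * X ^ i) (szegoQ (B t) n) := by
      conv_lhs => rw [as_sum_range_C_mul_X_pow' _ hlt, Finset.mul_sum, map_sum,
        LinearMap.sum_apply]
      exact Finset.sum_congr rfl fun i _ => by rw [mul_left_comm, form_C_mul_left]
    have e2 := form_eq_sum_left (B t) hlt (X * szegoQ (B t) n)
    have e3 : B t (X * szegoP (B t) (n + 1)) (szegoQ (B t) n) =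
        szegoCoeff (B t) (n + 1) * szegoNormSq (B t) (n + 1) := by
      rw [← sub_add_cancel (X * szegoP (B t) (n + 1))
          (C (szegoCoeff (B t) (n + 1)) * szegoQ (B t) (n + 1)), ← szegoP_succ, map_add,
        LinearMap.add_apply, form_C_mul_left,
        form_szegoP_right (hT t) (hQ.trans (by omega : n ≤ n + 2)),
        form_szegoQ_right (hT t) (hQ.trans n.le_succ), coeff_szegoQ_zero,
        coeff_eq_zero_of_natDegree_lt (hQ.trans_lt (by omega : n < n + 2))]
      ring
    have e4 : B t (szegoP (B t) (n + 1)) (X * szegoQ (B t) n) =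
        (szegoQ (B t) n).coeff n * szegoNormSq (B t) (n + 1) := by
      rw [form_szegoP_right (hT t), coeff_X_mul]
      have h1 := natDegree_mul_le (p := X) (q := szegoQ (B t) n)
      have h2 := natDegree_X_le (R := ℝ)
      omega
    rw [add_mul, ← e3, ← e4, e1, e2, ← Finset.sum_add_distrib, Finset.mul_sum]
    exact Finset.sum_congr rfl fun i _ => by ring
  have hfin := ((HasDerivAt.fun_sum fun i (_ : i ∈ Finset.range (n + 2)) => hterm i).div_const
    (szegoNormSq (B t) n)).const_sub (szegoCoeff (B t) n)
  rw [hsum] at hfin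
  change HasDerivAt (fun s => szegoCoeff (B s) n) _ t
  rw [heq]
  refine hfin.congr_deriv ?_
  change _ = -q * (1 - szegoCoeff (B t) n ^ 2) *
    (szegoCoeff (B t) (n + 1) + (szegoQ (B t) n).coeff n)
  rw [szegoNormSq_succ (hT t)]
  field_simp

lemma hasDerivAt_dCoeff (hsymm : μ.map (fun z : Circle => z⁻¹) = μ) (n : ℕ) (t : ℝ) :
    HasDerivAt (fun s => dCoeff (modified μ (q : ℂ) s) (n + 2))
      (4 * q * dCoeff (modified μ (q : ℂ) t) (n + 2) *
        (dCoeff (modified μ (q : ℂ) t) (n + 1) - dCoeff (modified μ (q : ℂ) t) (n + 3))) t := by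
  have hd : ∀ s m, dCoeff (modified μ (q : ℂ) s) (m + 2) =
      (1 - szegoCoeff (form (modified μ (q : ℂ) s)) (m + 1)) *
        (1 + szegoCoeff (form (modified μ (q : ℂ) s)) m) / 4 := fun s m =>
    dCoeff_add_two (support_modified_infinite μ hμ q s) (map_inv_modified hsymm q s) m
  have h1 := hasDerivAt_szegoCoeff hμ q (n + 1) t
  have h0 := hasDerivAt_szegoCoeff hμ q n t
  simp_rw [hd _ n]
  refine (((h1.const_sub 1).mul (h0.const_add 1)).div_const 4).congr_deriv ?_
  rw [coeff_szegoQ_succ_self, show n + 3 = (n + 1) + 2 from rfl, hd t (n + 1)]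
  rcases n with _ | n
  · rw [show dCoeff (modified μ (q : ℂ) t) (0 + 1) = 0 from rfl, szegoQ_zero, coeff_one_zero]
    ring
  · rw [coeff_szegoQ_succ_self, show n + 1 + 1 = n + 2 from rfl, hd t n]
    ring

end Modified

end CircleKernel

theorem mainTheorem5 (μ : MeasureTheory.Measure Circle) [MeasureTheory.IsFiniteMeasure μ]
    (hμ : μ.support.Infinite)
    (hsymm : μ.map (fun z : Circle => z⁻¹) = μ) (q : ℝ) :
    (∀ (t : ℝ) (c d : ℕ → ℝ),
      CircleKernel.IsRecurrence (CircleKernel.modified μ (q : ℂ) t) c d ↔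
        (∀ n : ℕ, 1 ≤ n → c n = CircleKernel.cCoeff (CircleKernel.modified μ (q : ℂ) t) n) ∧
        (∀ n : ℕ, 2 ≤ n → d n = CircleKernel.dCoeff (CircleKernel.modified μ (q : ℂ) t) n)) ∧
    (∀ n : ℕ, 1 ≤ n → ∀ t : ℝ,
      CircleKernel.cCoeff (CircleKernel.modified μ (q : ℂ) t) n = 0) ∧
    (∀ t : ℝ, CircleKernel.dCoeff (CircleKernel.modified μ (q : ℂ) t) 1 = 0) ∧
    (∀ n : ℕ, 2 ≤ n → ∀ t : ℝ,
      HasDerivAt (fun s : ℝ => CircleKernel.dCoeff (CircleKernel.modified μ (q : ℂ) s) n)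
        (4 * q * CircleKernel.dCoeff (CircleKernel.modified μ (q : ℂ) t) n *
          (CircleKernel.dCoeff (CircleKernel.modified μ (q : ℂ) t) (n - 1) -
            CircleKernel.dCoeff (CircleKernel.modified μ (q : ℂ) t) (n + 1))) t) := by
  have hsupp := CircleKernel.support_modified_infinite μ hμ (q : ℂ)
  have hinv := CircleKernel.map_inv_modified hsymm q
  refine ⟨fun t => CircleKernel.isRecurrence_iff (hsupp t) (hinv t),
    fun n hn t => CircleKernel.cCoeff_eq_zero (hsupp t) (hinv t) n hn, fun t => rfl,
    fun n hn t => ?_⟩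
  obtain ⟨n, rfl⟩ := Nat.exists_eq_add_of_le' hn
  exact CircleKernel.hasDerivAt_dCoeff hμ q hsymm n t
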